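/- Let $\mathcal H$ be a finite-dimensional complex Hilbert space with unitary group $U(\mathcal H)$, let $d\ge 2$, and let $K\le U(\mathcal H)$ be a subgroup containing a (necessarily central) element $J=e^{2\pi i/d}\mathbb 1$ of order $d$. Put $\bar K=K/\langle J\rangle$, and identify $\mathbb Z_d\cong\langle J\rangle$ by $a\mapsto J^a$. For a group $L$ let $NL$ be its nerve, the simplicial set with $(NL)_n=L^n$. Let $N(\mathbb Z_d,K)\subset NK$ be the simplicial subset of tuples $(k_1,\dots,k_n)$ with $k_i^d=1$ and $k_ik_j=k_jk_i$ for all $i,j$, and let $\bar N(\mathbb Z_d,K)\subset N\bar K$ be its image under $K\to\bar K$. Let $G$ be a subgroup of the normalizer of $K$ in $U(\mathcal H)$. It acts by conjugation on $K$ and on $\bar K$, hence on $N(\mathbb Z_d,K)$ and $\bar N(\mathbb Z_d,K)$; it acts trivially on $N\mathbb Z_d$. For a simplicial $G$-set $X$ let $X/\!/G=EG\times_G X$ be the Borel construction, where $(EG)_n=G^{n+1}$ has the faces $d_i(g_0,\dots,g_n)=(g_0,\dots,g_ig_{i+1},\dots,g_n)$ for $i<n$ and $d_n(g_0,\dots,g_n)=(g_0,\dots,g_{n-1})$,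 the degeneracies inserting $1$, and the $G$-action by left multiplication on $g_0$. Choose a set-theoretic section $\eta:\bar K\to K$ of the quotient map with $\eta(1)=1$, and let $\beta_G:(\bar N(\mathbb Z_d,K)/\!/G)_2\to\mathbb Z_d$ be the $2$-cocycle given by $$J^{\beta_G[(1,g_1,g_2),(x_1,x_2)]}=\eta(x_1)\cdot\bigl(g_1\cdot\eta(g_1^{-1}\cdot x_2)\bigr)\cdot\eta(x_1x_2)^{-1},$$ with class $[\beta_G]\in H^2(\bar N(\mathbb Z_d,K)/\!/G,\mathbb Z_d)$ in simplicial cohomology. For a set $V$ let $D(V)$ be the set of finitely supported probability distributions on $V$; applied levelwise, $D(Y)$ is a simplicial $G$-set for each simplicial $G$-set $Y$. A $G$-equivariant simplicial distribution is a simplicial $G$-map $p:X\to D(Y)$. It is called $G$-equivariantly contextual if there is no finitely supported probability distribution $w$ on the set of simplicial $G$-maps $r:X\to Y$ such that $p_\sigma(\theta)=\sum_{r:\,r_\sigma=\theta}w(r)$ for all $n$, $\sigma\in X_n$ and $\theta\in Y_n$. A density operator $\rho$ on $\mathcal H$ (a positive operator of trace $1$) is called $G$-invariant if $U\rho U^\dagger=\rho$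 for all $U\in G$. Its Born-rule distribution $\rho_*:N(\mathbb Z_d,K)\to D(N\mathbb Z_d)$ is the simplicial map $$(\rho_*)_{(k_1,\dots,k_n)}(a_1,\dots,a_n)=\operatorname{Tr}\bigl(\rho\,\Pi(a_1,\dots,a_n)\bigr),$$ where $\Pi(a_1,\dots,a_n)$ is the orthogonal projection onto the joint eigenspace $\{v: k_jv=e^{2\pi i a_j/d}v \text{ for } j=1,\dots,n\}$. If $\rho$ is $G$-invariant, $\rho_*$ is a $G$-equivariant simplicial distribution. If $[\beta_G]\neq 0$, then $\rho_*$ is $G$-equivariantly contextual for every $G$-invariant density operator $\rho$ on $\mathcal H$. -/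

import Mathlib

namespace EquivContext

universe u

open CategoryTheory Simplicial Opposite

noncomputable section

lemma typeHomExt {U V : Type u} {f g : U ⟶ V} (h : ∀ x : U, f x = g x) : f = g :=
  ConcreteCategory.hom_ext _ _ h

lemma ssetHomExt {X Y : SSet.{u}} {f g : X ⟶ Y}
    (h : ∀ (n : SimplexCategoryᵒᵖ) (x : X.obj n), f.app n x = g.app n x) : f = g :=
  NatTrans.ext (funext fun n => typeHomExt (h n))

/-! ### Nerves of groups -/

/-- The action of an ordinal map on tuples: `(f^* k)ᵢ = k_{f(i-1)+1} ⋯ k_{f(i)}`, written as a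
quotient of partial products `k₁ ⋯ k_j`. -/
def tuplePullback {K : Type u} [Group K] {m n : ℕ} (f : Fin (m + 1) → Fin (n + 1))
    (k : Fin n → K) : Fin m → K :=
  fun i => (Fin.partialProd k (f i.castSucc))⁻¹ * Fin.partialProd k (f i.succ)

lemma partialProd_tuplePullback {K : Type u} [Group K] {m n : ℕ}
    (f : Fin (m + 1) → Fin (n + 1)) (k : Fin n → K) (j : Fin (m + 1)) :
    Fin.partialProd (tuplePullback f k) j =
      (Fin.partialProd k (f 0))⁻¹ * Fin.partialProd k (f j) := by
  induction j using Fin.induction with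
  | zero => simp
  | succ i ih => rw [Fin.partialProd_succ, ih, tuplePullback]; group

lemma tuplePullback_comp {K : Type u} [Group K] {l m n : ℕ}
    (f : Fin (m + 1) → Fin (n + 1)) (g : Fin (l + 1) → Fin (m + 1)) (k : Fin n → K) :
    tuplePullback g (tuplePullback f k) = tuplePullback (f ∘ g) k := by
  funext i
  rw [tuplePullback, partialProd_tuplePullback, partialProd_tuplePullback]
  simp [tuplePullback]

lemma partialProd_map {K L : Type u} [Group K] [Group L] (f : K →* L) {n : ℕ}
    (k : Fin n → K) (j : Fin (n + 1)) :
    Fin.partialProd (fun i => f (k i)) j = f (Fin.partialProd k j) := by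
  induction j using Fin.induction with
  | zero => simp
  | succ i ih => rw [Fin.partialProd_succ, Fin.partialProd_succ, ih, map_mul]

lemma tuplePullback_map {K L : Type u} [Group K] [Group L] (φ : K →* L) {m n : ℕ}
    (f : Fin (m + 1) → Fin (n + 1)) (k : Fin n → K) :
    tuplePullback f (fun i => φ (k i)) = fun i => φ (tuplePullback f k i) := by
  funext i
  simp [tuplePullback, partialProd_map]

/-- The nerve of a group `K`: `n`-simplices are the tuples `(k₁, …, kₙ)`. -/
def groupNerve (K : Type u) [Group K] : SSet.{u} where
  obj n := Fin n.unop.len → K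
  map θ := TypeCat.ofHom fun k => tuplePullback θ.unop.toOrderHom k
  map_id _ := typeHomExt fun k => funext fun i =>
    Fin.partialProd_right_inv k i
  map_comp θ τ := typeHomExt fun k =>
    (tuplePullback_comp θ.unop.toOrderHom τ.unop.toOrderHom k).symm

/-- The map of nerves induced by a group homomorphism. -/
def groupNerveMap {K L : Type u} [Group K] [Group L] (φ : K →* L) :
    groupNerve K ⟶ groupNerve L where
  app _ := TypeCat.ofHom fun k i => φ (k i)
  naturality _ _ θ := typeHomExt fun k =>
    (tuplePullback_map φ θ.unop.toOrderHom k).symm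

/-- Pairwise commuting `d`-torsion tuples. -/
def IsCommTorsion (d : ℕ) {K : Type u} [Group K] {n : ℕ} (k : Fin n → K) : Prop :=
  (∀ i, k i ^ d = 1) ∧ ∀ i j, k i * k j = k j * k i

lemma IsCommTorsion.face {d : ℕ} {K : Type u} [Group K] {m n : ℕ} {k : Fin n → K}
    (hk : IsCommTorsion d k) (f : Fin (m + 1) → Fin (n + 1)) :
    IsCommTorsion d (tuplePullback f k) := by
  have h1 : ∀ i j, Commute (k i) (Fin.partialProd k j) := fun i j => by
    induction j using Fin.induction with
    | zero => simp
    | succ j ih => rw [Fin.partialProd_succ]; exact ih.mul_right (hk.2 i j)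
  have h2 : ∀ i j, Commute (Fin.partialProd k i) (Fin.partialProd k j) := fun i j => by
    induction i using Fin.induction with
    | zero => simp
    | succ i ih => rw [Fin.partialProd_succ]; exact ih.mul_left (h1 i j)
  have h3 : ∀ j, Fin.partialProd k j ^ d = 1 := fun j => by
    induction j using Fin.induction with
    | zero => simp
    | succ j ih => rw [Fin.partialProd_succ, (h1 j _).symm.mul_pow, ih, hk.1, one_mul]
  refine ⟨fun i => ?_, fun i j => ?_⟩
  · rw [tuplePullback, (h2 _ _).inv_left.mul_pow, inv_pow, h3, h3]; simp
  · exact ((h2 _ _).inv_inv.mul_right (h2 _ _).inv_left).mul_left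
      ((h2 _ _).inv_right.mul_right (h2 _ _))

/-- The partial group `N(ℤ_d, K)` as a simplicial subset of the nerve `N K`. -/
def torsionNerve (d : ℕ) (K : Type u) [Group K] : (groupNerve K).Subcomplex where
  obj _ := {k | IsCommTorsion d k}
  map θ _ hk := IsCommTorsion.face hk θ.unop.toOrderHom

/-- The map `N(ℤ_d, K) → N(ℤ_d, L)` induced by a group homomorphism. -/
def torsionNerveMap (d : ℕ) {K L : Type u} [Group K] [Group L] (f : K →* L) :
    (torsionNerve d K : SSet.{u}) ⟶ (torsionNerve d L : SSet.{u}) where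
  app _ := TypeCat.ofHom fun k => ⟨fun i => f (k.1 i),
    fun i => by change f (k.1 i) ^ d = 1; rw [← map_pow, k.2.1 i, map_one],
    fun i j => by
      change f (k.1 i) * f (k.1 j) = f (k.1 j) * f (k.1 i)
      rw [← map_mul, k.2.2 i j, map_mul]⟩
  naturality _ _ θ := typeHomExt fun k =>
    Subtype.ext (tuplePullback_map f θ.unop.toOrderHom k.1).symm

/-! ### Central elements and the quotient partial group -/

/-- A central element of order `d` in a group `K`. -/
structure CentralElement (K : Type u) [Group K] (d : ℕ) where
  /-- the element -/
  val : K
  mem_center : val ∈ Subgroup.center K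
  orderOf_eq : orderOf val = d

instance {K : Type u} [Group K] {d : ℕ} (J : CentralElement K d) :
    (Subgroup.zpowers J.val).Normal where
  conj_mem k hk g := by
    have : k ∈ Subgroup.center K := (Subgroup.zpowers_le.2 J.mem_center) hk
    rwa [Subgroup.mem_center_iff.1 this g, mul_inv_cancel_right]

/-- The quotient group `K̄ = K / ⟨J⟩`. -/
abbrev CentralElement.Quot {K : Type u} [Group K] {d : ℕ} (J : CentralElement K d) : Type u :=
  K ⧸ Subgroup.zpowers J.val

/-- The partial group `N̄(ℤ_d, K)` as a simplicial subset of `N K̄`: its `n`-simplices are the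
tuples that can be lifted to `n`-simplices of `N(ℤ_d, K)`. -/
def barTorsionNerve {K : Type u} [Group K] {d : ℕ} (J : CentralElement K d) :
    (groupNerve J.Quot).Subcomplex where
  obj n := {x | ∃ k : Fin n.unop.len → K, IsCommTorsion d k ∧ ∀ i, (k i : J.Quot) = x i}
  map θ x := by
    rintro ⟨k, hk, hx⟩
    refine ⟨_, IsCommTorsion.face hk θ.unop.toOrderHom, fun i => ?_⟩
    obtain rfl : (fun i => (k i : J.Quot)) = x := funext hx
    exact (congrFun (tuplePullback_map (QuotientGroup.mk' (Subgroup.zpowers J.val))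
      θ.unop.toOrderHom k) i).symm

/-! ### Group actions -/

/-- The simplicial `G`-set `N(ℤ_d, K)` for a group `G` acting on `K` by automorphisms. -/
def torsionNerveAction (d : ℕ) {K G : Type u} [Group K] [Group G] (φ : G →* MulAut K) :
    Action SSet.{u} G where
  V := torsionNerve d K
  ρ :=
    { toFun := fun g => torsionNerveMap d (φ g).toMonoidHom
      map_one' := by
        refine ssetHomExt fun n k => Subtype.ext (funext fun i => ?_)
        change φ 1 (k.1 i) = k.1 i
        simp
      map_mul' := fun g h => by
        refine ssetHomExt fun n k => Subtype.ext (funext fun i => ?_)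
        change φ (g * h) (k.1 i) = φ g (φ h (k.1 i))
        simp }

section Quotient

variable {K G : Type u} [Group K] [Group G] {d : ℕ} (J : CentralElement K d)
  (φ : G →* MulAut K) (hφ : ∀ g, φ g J.val = J.val)

/-- The automorphism of `K̄ = K / ⟨J⟩` induced by the action of `g` on `K`. -/
def quotMap (g : G) : J.Quot →* J.Quot :=
  QuotientGroup.map _ _ (φ g).toMonoidHom (by
    rw [Subgroup.zpowers_le, Subgroup.mem_comap]
    change φ g J.val ∈ _
    rw [hφ]
    exact Subgroup.mem_zpowers _)

@[simp] lemma quotMap_mk (g : G) (k : K) : quotMap J φ hφ g (k : J.Quot) = (φ g k : K) := rfl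

lemma quotMap_one (x : J.Quot) : quotMap J φ hφ 1 x = x := by
  induction x using QuotientGroup.induction_on with
  | H k => simp

lemma quotMap_mul (g h : G) (x : J.Quot) :
    quotMap J φ hφ (g * h) x = quotMap J φ hφ g (quotMap J φ hφ h x) := by
  induction x using QuotientGroup.induction_on with
  | H k => simp

/-- The simplicial `G`-set `N̄(ℤ_d, K)`. -/
def barTorsionNerveAction : Action SSet.{u} G where
  V := barTorsionNerve J
  ρ :=
    { toFun := fun g =>
        { app := fun _ => TypeCat.ofHom fun x => ⟨fun i => quotMap J φ hφ g (x.1 i), by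
            obtain ⟨k, hk, hx⟩ := x.2
            refine ⟨fun i => φ g (k i), ⟨fun i => ?_, fun i j => ?_⟩, fun i => ?_⟩
            · rw [← map_pow, hk.1, map_one]
            · rw [← map_mul, hk.2, map_mul]
            · exact (congrArg (quotMap J φ hφ g) (hx i))⟩
          naturality := fun _ _ θ => typeHomExt fun x =>
            Subtype.ext (tuplePullback_map (quotMap J φ hφ g) θ.unop.toOrderHom x.1).symm }
      map_one' := by
        exact ssetHomExt fun n x => Subtype.ext (funext fun i => quotMap_one J φ hφ (x.1 i))
      map_mul' := fun g h => by
        exact ssetHomExt fun n x => Subtype.ext (funext fun i => quotMap_mul J φ hφ g h (x.1 i)) }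

end Quotient

/-! ### The Borel construction -/

/-- The simplicial set `EG`. An `n`-simplex `(g₀, g₁, …, gₙ)` is stored as
`(g₀, (g₁, …, gₙ))`. -/
def universalBundleSSet (G : Type u) [Group G] : SSet.{u} where
  obj n := G × (Fin n.unop.len → G)
  map θ := TypeCat.ofHom fun e =>
    (e.1 * Fin.partialProd e.2 (θ.unop.toOrderHom 0), tuplePullback θ.unop.toOrderHom e.2)
  map_id _ := typeHomExt fun e => Prod.ext
    (by change e.1 * Fin.partialProd e.2 0 = e.1; simp)
    (funext fun i => Fin.partialProd_right_inv e.2 i)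
  map_comp θ τ := typeHomExt fun e => Prod.ext
    (by
      change e.1 * Fin.partialProd e.2 (θ.unop.toOrderHom (τ.unop.toOrderHom 0)) =
        e.1 * Fin.partialProd e.2 (θ.unop.toOrderHom 0) *
          Fin.partialProd (tuplePullback θ.unop.toOrderHom e.2) (τ.unop.toOrderHom 0)
      rw [partialProd_tuplePullback]; group)
    (tuplePullback_comp θ.unop.toOrderHom τ.unop.toOrderHom e.2).symm

/-- The simplicial `G`-set `EG`: the group acts by left multiplication on `g₀`. -/
def universalBundle (G : Type u) [Group G] : Action SSet.{u} G where
  V := universalBundleSSet G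
  ρ :=
    { toFun := fun h =>
        { app := fun _ => TypeCat.ofHom fun (e : G × _) => (h * e.1, e.2)
          naturality := fun _ _ _ => typeHomExt fun _ => Prod.ext
            (mul_assoc _ _ _).symm rfl }
      map_one' := ssetHomExt fun _ _ => Prod.ext (one_mul _) rfl
      map_mul' := fun _ _ => ssetHomExt fun _ _ => Prod.ext (mul_assoc _ _ _) rfl }

section Borel

variable {G : Type u} [Group G] (X : Action SSet.{u} G)

/-- The orbit relation of the diagonal action of `G` on `(EG)ₙ × Xₙ`. -/
def borelSetoid (n : SimplexCategoryᵒᵖ) :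
    Setoid ((universalBundle G).V.obj n × X.V.obj n) where
  r p q := ∃ h : G, q = (((universalBundle G).ρ h).app n p.1, (X.ρ h).app n p.2)
  iseqv :=
    { refl := fun p => ⟨1, by simp⟩
      symm := by
        rintro p q ⟨h, rfl⟩
        refine ⟨h⁻¹, Prod.ext ?_ ?_⟩
        · have := map_mul (universalBundle G).ρ h⁻¹ h
          rw [inv_mul_cancel, map_one] at this
          exact ConcreteCategory.congr_hom (NatTrans.congr_app this n) p.1
        · have := map_mul X.ρ h⁻¹ h
          rw [inv_mul_cancel, map_one] at this
          exact ConcreteCategory.congr_hom (NatTrans.congr_app this n) p.2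
      trans := by
        rintro p q r ⟨h, rfl⟩ ⟨h', rfl⟩
        refine ⟨h' * h, Prod.ext ?_ ?_⟩
        · exact (ConcreteCategory.congr_hom
            (NatTrans.congr_app (map_mul (universalBundle G).ρ h' h) n) p.1).symm
        · exact (ConcreteCategory.congr_hom
            (NatTrans.congr_app (map_mul X.ρ h' h) n) p.2).symm }

/-- The Borel construction `X // G = EG ×_G X`, with diagonal simplicial structure. -/
def borel : SSet.{u} where
  obj n := Quotient (borelSetoid X n)
  map {m n} θ := TypeCat.ofHom (Quotient.map
    (fun p => ((universalBundle G).V.map θ p.1, X.V.map θ p.2)) (by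
      rintro p q ⟨h, rfl⟩
      exact ⟨h, Prod.ext
        (ConcreteCategory.congr_hom (((universalBundle G).ρ h).naturality θ) p.1).symm
        (ConcreteCategory.congr_hom ((X.ρ h).naturality θ) p.2).symm⟩))
  map_id n := typeHomExt fun p => by
    induction p using Quotient.inductionOn with
    | h p => exact congrArg _ (Prod.ext
        (ConcreteCategory.congr_hom ((universalBundle G).V.map_id n) p.1)
        (ConcreteCategory.congr_hom (X.V.map_id n) p.2))
  map_comp θ τ := typeHomExt fun p => by
    induction p using Quotient.inductionOn with
    | h p => exact congrArg _ (Prod.ext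
        (ConcreteCategory.congr_hom ((universalBundle G).V.map_comp θ τ) p.1)
        (ConcreteCategory.congr_hom (X.V.map_comp θ τ) p.2))

end Borel

/-! ### Cohomology -/

section Cohomology

variable (X : SSet.{u}) (A : Type) [AddCommGroup A]

/-- The simplicial coboundary `(δ f)(x) = ∑ᵢ (-1)ⁱ f(dᵢ x)`. -/
def coboundary (n : ℕ) : (X _⦋n⦌ → A) →+ (X _⦋n + 1⦌ → A) where
  toFun f x := ∑ i : Fin (n + 2), (-1 : ℤ) ^ (i : ℕ) • f (X.δ i x)
  map_zero' := by funext x; simp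
  map_add' f g := by funext x; simp [Finset.sum_add_distrib]

/-- The second simplicial cohomology group `H²(X, A)`. -/
abbrev H2 : Type u :=
  (coboundary X A 2).ker ⧸ ((coboundary X A 1).range.addSubgroupOf (coboundary X A 2).ker)

end Cohomology

/-! ### The class `[β_G]` -/

section Section

variable {K G : Type u} [Group K] [Group G] {d : ℕ} (J : CentralElement K d)
  (φ : G →* MulAut K) (hφ : ∀ g, φ g J.val = J.val)

/-- A set-theoretic section `η : K̄ → K` of the quotient map with `η(1) = 1`. -/
structure NormalizedSection where
  /-- the section -/
  toFun : J.Quot → K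
  mk_toFun : ∀ x, ((toFun x : K) : J.Quot) = x
  map_one : toFun 1 = 1

variable {J} (η : NormalizedSection J)

/-- `η(x₁) · (g · η(g⁻¹ x₂)) · η(x₁ x₂)⁻¹`, which is an element of `⟨J⟩`. -/
def sectionDefect (g : G) (x₁ x₂ : J.Quot) : K :=
  η.toFun x₁ * φ g (η.toFun (quotMap J φ hφ g⁻¹ x₂)) * (η.toFun (x₁ * x₂))⁻¹

lemma mk_conjSection (g : G) (x : J.Quot) :
    ((φ g (η.toFun (quotMap J φ hφ g⁻¹ x)) : K) : J.Quot) = x := by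
  rw [← quotMap_mk J φ hφ, η.mk_toFun, ← quotMap_mul, mul_inv_cancel, quotMap_one]

lemma sectionDefect_mem (g : G) (x₁ x₂ : J.Quot) :
    sectionDefect φ hφ η g x₁ x₂ ∈ Subgroup.zpowers J.val := by
  rw [← QuotientGroup.eq_one_iff, sectionDefect]
  simp only [QuotientGroup.mk_mul, QuotientGroup.mk_inv]
  rw [mk_conjSection, η.mk_toFun, η.mk_toFun, mul_inv_cancel]

end Section

section Log

variable {K : Type u} [Group K] {d : ℕ} [NeZero d] (J : CentralElement K d)

/-- The exponent of an element of `⟨J⟩`, that is, the inverse of the isomorphism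
`ℤ_d ≅ ⟨J⟩`, `a ↦ J ^ a` (it is only used on `⟨J⟩`). -/
def CentralElement.log (k : K) : ZMod d :=
  Function.invFun (fun a : ZMod d => J.val ^ a.val) k

lemma CentralElement.pow_log {k : K} (hk : k ∈ Subgroup.zpowers J.val) :
    J.val ^ (J.log k).val = k := by
  apply Function.invFun_eq (f := fun a : ZMod d => J.val ^ a.val)
  obtain ⟨z, rfl⟩ := hk
  refine ⟨(z : ZMod d), ?_⟩
  have h : ((((z : ZMod d).val : ℕ) : ℤ)) = z % (orderOf J.val : ℤ) := by
    rw [J.orderOf_eq, ZMod.val_intCast]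
  change J.val ^ (z : ZMod d).val = J.val ^ z
  rw [← zpow_natCast, h, zpow_mod_orderOf]

lemma CentralElement.pow_val_inj {a b : ZMod d} (h : J.val ^ a.val = J.val ^ b.val) : a = b := by
  rw [pow_inj_mod, J.orderOf_eq, Nat.mod_eq_of_lt a.val_lt, Nat.mod_eq_of_lt b.val_lt] at h
  exact ZMod.val_injective d h

lemma CentralElement.pow_val_add (a b : ZMod d) :
    J.val ^ (a + b).val = J.val ^ a.val * J.val ^ b.val := by
  rw [← pow_add, ZMod.val_add, pow_inj_mod, J.orderOf_eq, Nat.mod_mod]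

lemma CentralElement.log_mul {k l : K} (hk : k ∈ Subgroup.zpowers J.val)
    (hl : l ∈ Subgroup.zpowers J.val) : J.log (k * l) = J.log k + J.log l := by
  apply J.pow_val_inj
  rw [J.pow_val_add, J.pow_log (mul_mem hk hl), J.pow_log hk, J.pow_log hl]

end Log

section Cocycle

variable {K G : Type u} [Group K] [Group G] {d : ℕ} [NeZero d] {J : CentralElement K d}
  (φ : G →* MulAut K) (hφ : ∀ g, φ g J.val = J.val) (η : NormalizedSection J)

/-- The value of `β_G` on `[(g₀, g₁, g₂), (x₁, x₂)] = [(1, g₁, g₂), (g₀⁻¹ x₁, g₀⁻¹ x₂)]`. -/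
def betaGRep (e : G × (Fin 2 → G)) (x : Fin 2 → J.Quot) : ZMod d :=
  J.log (sectionDefect φ hφ η (e.2 0)
    (quotMap J φ hφ e.1⁻¹ (x 0)) (quotMap J φ hφ e.1⁻¹ (x 1)))

/-- The `2`-cochain `β_G : (N̄(ℤ_d, K) // G)₂ → ℤ_d`,
`J ^ β_G[(1, g₁, g₂), (x₁, x₂)] = η(x₁) · (g₁ · η(g₁⁻¹ x₂)) · η(x₁ x₂)⁻¹`.
It measures the failure of the pseudo-section
`[(1, g₁, …, gₙ), x] ↦ [(1, g₁, …, gₙ), η(x)]` of `N(ℤ_d, K) // G → N̄(ℤ_d, K) // G`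
to be multiplicative. -/
def betaG : (borel (barTorsionNerveAction J φ hφ)) _⦋2⦌ → ZMod d :=
  Quotient.lift
    (fun p => betaGRep φ hφ η p.1 ((barTorsionNerve J).ι.app (op ⦋2⦌) p.2)) (by
      rintro ⟨⟨g₀, g⟩, x⟩ q ⟨h, rfl⟩
      have key : ∀ y : J.Quot, quotMap J φ hφ (h * g₀)⁻¹ (quotMap J φ hφ h y) =
          quotMap J φ hφ g₀⁻¹ y := fun y => by
        rw [← quotMap_mul]; congr 1; group
      change J.log (sectionDefect φ hφ η (g 0) (quotMap J φ hφ g₀⁻¹ (x.1 (0 : Fin 2)))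
          (quotMap J φ hφ g₀⁻¹ (x.1 (1 : Fin 2)))) =
        J.log (sectionDefect φ hφ η (g 0)
          (quotMap J φ hφ (h * g₀)⁻¹ (quotMap J φ hφ h (x.1 (0 : Fin 2))))
          (quotMap J φ hφ (h * g₀)⁻¹ (quotMap J φ hφ h (x.1 (1 : Fin 2)))))
      rw [key, key])

lemma tuplePullback_two {L : Type u} [Group L] (f : Fin 3 → Fin 4) (k : Fin 3 → L) :
    tuplePullback f k = ![(Fin.partialProd k (f 0))⁻¹ * Fin.partialProd k (f 1),
      (Fin.partialProd k (f 1))⁻¹ * Fin.partialProd k (f 2)] := by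
  funext i
  fin_cases i <;> rfl

lemma partialProd_three {L : Type u} [Group L] (k : Fin 3 → L) :
    Fin.partialProd k 0 = 1 ∧ Fin.partialProd k 1 = k 0 ∧
      Fin.partialProd k 2 = k 0 * k 1 ∧ Fin.partialProd k 3 = k 0 * k 1 * k 2 := by
  refine ⟨?_, ?_, ?_, ?_⟩ <;> simp [Fin.partialProd, List.ofFn_succ, mul_assoc]

/-- The cocycle identity for the section defects. -/
lemma log_sectionDefect_cocycle (g₁ g₂ : G) (y₁ y₂ y₃ : J.Quot) :
    J.log (sectionDefect φ hφ η g₂ (quotMap J φ hφ g₁⁻¹ y₂) (quotMap J φ hφ g₁⁻¹ y₃)) +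
        J.log (sectionDefect φ hφ η g₁ y₁ (y₂ * y₃)) =
      J.log (sectionDefect φ hφ η (g₁ * g₂) (y₁ * y₂) y₃) +
        J.log (sectionDefect φ hφ η g₁ y₁ y₂) := by
  have m := sectionDefect_mem φ hφ η
  rw [← J.log_mul (m ..) (m ..), ← J.log_mul (m ..) (m ..)]
  congr 1
  -- the defect is fixed by `G` and central
  have hfix : ∀ (g : G) (k : K), k ∈ Subgroup.zpowers J.val → φ g k = k := by
    rintro g _ ⟨z, rfl⟩
    change φ g (J.val ^ z) = J.val ^ z
    rw [map_zpow, hφ]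
  have hcen : ∀ k ∈ Subgroup.zpowers J.val, ∀ l : K, l * k = k * l := fun k hk =>
    Subgroup.mem_center_iff.1 ((Subgroup.zpowers_le.2 J.mem_center) hk)
  have e1 : sectionDefect φ hφ η g₂ (quotMap J φ hφ g₁⁻¹ y₂) (quotMap J φ hφ g₁⁻¹ y₃) =
      φ g₁ (η.toFun (quotMap J φ hφ g₁⁻¹ y₂)) *
        φ (g₁ * g₂) (η.toFun (quotMap J φ hφ (g₁ * g₂)⁻¹ y₃)) *
        (φ g₁ (η.toFun (quotMap J φ hφ g₁⁻¹ (y₂ * y₃))))⁻¹ := by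
    rw [← hfix g₁ _ (m g₂ (quotMap J φ hφ g₁⁻¹ y₂) (quotMap J φ hφ g₁⁻¹ y₃)), sectionDefect,
      ← quotMap_mul, ← mul_inv_rev, map_mul, map_mul, map_inv, map_mul φ g₁ g₂, MulAut.mul_apply,
      map_mul (quotMap J φ hφ g₁⁻¹)]
  have e2 : sectionDefect φ hφ η g₁ y₁ (y₂ * y₃) =
      η.toFun y₁ * φ g₁ (η.toFun (quotMap J φ hφ g₁⁻¹ (y₂ * y₃))) *
        (η.toFun (y₁ * y₂ * y₃))⁻¹ := by rw [sectionDefect, mul_assoc y₁]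
  have c := hcen _ (m g₂ (quotMap J φ hφ g₁⁻¹ y₂) (quotMap J φ hφ g₁⁻¹ y₃)) (η.toFun y₁)
  have c' := hcen _ (m g₁ y₁ y₂) (sectionDefect φ hφ η (g₁ * g₂) (y₁ * y₂) y₃)
  rw [c', e2, mul_assoc (η.toFun y₁), ← mul_assoc (sectionDefect φ hφ η g₂ _ _), ← c, e1,
    sectionDefect, sectionDefect]
  group

lemma betaGRep_cocycle (g₀ : G) (g : Fin 3 → G) (y : Fin 3 → J.Quot) :
    ∑ i : Fin 4, (-1 : ℤ) ^ (i : ℕ) • betaGRep φ hφ η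
      (g₀ * Fin.partialProd g (i.succAbove 0), tuplePullback i.succAbove g)
      (tuplePullback i.succAbove y) = 0 := by
  obtain ⟨a0, a1, a2, a3⟩ := partialProd_three g
  obtain ⟨b0, b1, b2, b3⟩ := partialProd_three y
  have key := log_sectionDefect_cocycle φ hφ η (g 0) (g 1) (quotMap J φ hφ g₀⁻¹ (y 0))
    (quotMap J φ hφ g₀⁻¹ (y 1)) (quotMap J φ hφ g₀⁻¹ (y 2))
  have s0 : ((0 : Fin 4).succAbove : Fin 3 → Fin 4) = ![1, 2, 3] := by decide
  have s1 : ((1 : Fin 4).succAbove : Fin 3 → Fin 4) = ![0, 2, 3] := by decide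
  have s2 : ((2 : Fin 4).succAbove : Fin 3 → Fin 4) = ![0, 1, 3] := by decide
  have s3 : ((3 : Fin 4).succAbove : Fin 3 → Fin 4) = ![0, 1, 2] := by decide
  rw [Fin.sum_univ_four]
  simp only [betaGRep, tuplePullback_two, s0, s1, s2, s3]
  simp only [Matrix.cons_val_zero, Matrix.cons_val_one, Matrix.cons_val, a0, a1, a2, a3,
    b0, b1, b2, b3, mul_inv_rev, quotMap_mul, map_mul, mul_assoc, inv_mul_cancel_left, inv_one,
    one_mul, mul_one]
  simp
  linear_combination key

lemma betaG_mem_ker :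
    betaG φ hφ η ∈ (coboundary (borel (barTorsionNerveAction J φ hφ)) (ZMod d) 2).ker := by
  rw [AddMonoidHom.mem_ker]
  funext σ
  induction σ using Quotient.inductionOn with
  | h p => exact betaGRep_cocycle φ hφ η p.1.1 p.1.2 ((barTorsionNerve J).ι.app (op ⦋3⦌) p.2)

/-- The class `[β_G] ∈ H²(N̄(ℤ_d, K) // G, ℤ_d)`. -/
def betaGClass : H2 (borel (barTorsionNerveAction J φ hφ)) (ZMod d) :=
  QuotientAddGroup.mk ⟨betaG φ hφ η, betaG_mem_ker φ hφ η⟩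

end Cocycle

/-! ### Distributions and equivariant contextuality -/

/-- The distribution monad `D = D_{ℝ≥0}` as a functor on sets. -/
def distFunctor : Type u ⥤ Type u where
  obj U := Convexity.StdSimplex ℝ U
  map f := TypeCat.ofHom fun p => p.map f
  map_id _ := typeHomExt fun p => Convexity.StdSimplex.map_id p
  map_comp f g := typeHomExt fun p => Convexity.StdSimplex.map_comp p f g

/-- `D(Y)` for a simplicial `G`-set `Y`, with the induced action `(g · p)(y) = p(g⁻¹ · y)`. -/
abbrev distAction {G : Type u} [Group G] (Y : Action SSet.{u} G) : Action SSet.{u} G :=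
  (((SimplicialObject.whiskering (Type u) (Type u)).obj distFunctor).mapAction G).obj Y

/-- The comparison map `Θ_G` from distributions on the set of `G`-equivariant deterministic
distributions, i.e. of simplicial `G`-maps `r : X → Y`, to `G`-equivariant simplicial
distributions: `Θ_G(w)_σ(θ) = ∑_{r : r_σ = θ} w(r)`. -/
def thetaG {G : Type u} [Group G] (X Y : Action SSet.{u} G)
    (w : Convexity.StdSimplex ℝ (X ⟶ Y)) : X ⟶ distAction Y where
  hom :=
    { app := fun n => TypeCat.ofHom fun σ => w.map fun r => r.hom.app n σ
      naturality := fun m n θ => typeHomExt fun σ => by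
        change (w.map fun r => r.hom.app n (X.V.map θ σ)) =
          (w.map fun r => r.hom.app m σ).map (Y.V.map θ)
        rw [Convexity.StdSimplex.map_map]
        congr 1
        funext r
        exact ConcreteCategory.congr_hom (r.hom.naturality θ) σ }
  comm g := ssetHomExt fun n σ => by
    change (w.map fun r => r.hom.app n ((X.ρ g).app n σ)) =
      (w.map fun r => r.hom.app n σ).map ((Y.ρ g).app n)
    rw [Convexity.StdSimplex.map_map]
    congr 1
    funext r
    exact ConcreteCategory.congr_hom (NatTrans.congr_app (r.comm g) n) σ

/-- A `G`-equivariant simplicial distribution `p : X → D(Y)` is `G`-equivariantly contextual if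
it is not in the image of `Θ_G`. -/
def IsEquivariantlyContextual {G : Type u} [Group G] {X Y : Action SSet.{u} G}
    (p : X ⟶ distAction Y) : Prop :=
  p ∉ Set.range (thetaG X Y)

/-! ### Quantum distributions -/

/-- The group `ℤ_d`, written multiplicatively. -/
abbrev Zd (d : ℕ) : Type u := ULift.{u} (Multiplicative (ZMod d))

section Quantum

variable {H : Type u} [NormedAddCommGroup H] [InnerProductSpace ℂ H]
  {d : ℕ} [NeZero d]

/-- The character `a ↦ e^{2πia/d}` of `ℤ_d`. -/
def zdChar (a : Zd.{u} d) : ℂ := ZMod.stdAddChar a.down.toAdd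

/-- The joint eigenspace of a tuple of unitary operators `(A₁, …, Aₙ)` for the eigenvalues
`e^{2πi a₁/d}, …, e^{2πi aₙ/d}`. -/
def jointEigenspace {n : ℕ} (A : Fin n → (H ≃ₗᵢ[ℂ] H)) (a : Fin n → Zd.{u} d) : Submodule ℂ H :=
  ⨅ i, Module.End.eigenspace (A i).toLinearEquiv.toLinearMap (zdChar (a i))

lemma zdChar_mul (a b : Zd.{u} d) : zdChar (a * b) = zdChar a * zdChar b :=
  AddChar.map_add_eq_mul _ _ _

lemma zdChar_one : zdChar (1 : Zd.{u} d) = 1 := AddChar.map_zero_eq_one _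

lemma zdChar_inv_mul (a : Zd.{u} d) : zdChar a⁻¹ * zdChar a = 1 := by
  rw [← zdChar_mul, inv_mul_cancel, zdChar_one]

lemma zdChar_injective : Function.Injective (zdChar : Zd.{u} d → ℂ) := fun _ _ h =>
  ULift.ext _ _ (Multiplicative.toAdd.injective (ZMod.injective_stdAddChar h))

lemma norm_zdChar (a : Zd.{u} d) : ‖zdChar a‖ = 1 := Circle.norm_coe _

lemma exists_zdChar {z : ℂ} (hz : z ^ d = 1) : ∃ a : Zd.{u} d, zdChar a = z := by
  obtain ⟨i, -, hi⟩ := (Complex.isPrimitiveRoot_exp d (NeZero.ne d)).eq_pow_of_pow_eq_one hz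
  refine ⟨⟨Multiplicative.ofAdd ((i : ℤ) : ZMod d)⟩, ?_⟩
  change ZMod.stdAddChar ((i : ℤ) : ZMod d) = z
  rw [ZMod.stdAddChar_coe, ← hi, ← Complex.exp_nat_mul]
  congr 1
  push_cast
  ring

lemma mem_jointEigenspace {n : ℕ} {A : Fin n → (H ≃ₗᵢ[ℂ] H)} {a : Fin n → Zd.{u} d} {v : H} :
    v ∈ jointEigenspace A a ↔ ∀ i, A i v = zdChar (a i) • v := by
  simp [jointEigenspace, Submodule.mem_iInf]

lemma partialProd_apply {n : ℕ} {A : Fin n → (H ≃ₗᵢ[ℂ] H)} {a : Fin n → Zd.{u} d} {v : H}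
    (hv : v ∈ jointEigenspace A a) (j : Fin (n + 1)) :
    Fin.partialProd A j v = zdChar (Fin.partialProd a j) • v := by
  induction j using Fin.induction with
  | zero => simp [zdChar_one]
  | succ i ih =>
    rw [Fin.partialProd_succ, Fin.partialProd_succ, zdChar_mul, LinearIsometryEquiv.coe_mul,
      Function.comp_apply, mem_jointEigenspace.1 hv, map_smul, ih, smul_smul, mul_comm]

lemma jointEigenspace_le {m n : ℕ} (A : Fin n → (H ≃ₗᵢ[ℂ] H)) (a : Fin n → Zd.{u} d)
    (f : Fin (m + 1) → Fin (n + 1)) :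
    jointEigenspace A a ≤ jointEigenspace (tuplePullback f A) (tuplePullback f a) := by
  intro v hv
  rw [mem_jointEigenspace]
  intro i
  rw [tuplePullback, tuplePullback, LinearIsometryEquiv.coe_mul, Function.comp_apply,
    partialProd_apply hv, map_smul, zdChar_mul, mul_comm, ← smul_smul]
  congr 1
  change (Fin.partialProd A (f i.castSucc)).symm v = _
  rw [LinearIsometryEquiv.symm_apply_eq, map_smul, partialProd_apply hv, smul_smul,
    zdChar_inv_mul, one_smul]

lemma jointEigenspace_orthogonal {n : ℕ} (A : Fin n → (H ≃ₗᵢ[ℂ] H)) {a b : Fin n → Zd.{u} d}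
    (hab : a ≠ b) : jointEigenspace A a ⟂ jointEigenspace A b := by
  obtain ⟨i, hi⟩ := Function.ne_iff.1 hab
  rw [Submodule.isOrtho_iff_inner_eq]
  intro v hv w hw
  have h := (A i).inner_map_map v w
  rw [mem_jointEigenspace.1 hv, mem_jointEigenspace.1 hw, inner_smul_left, inner_smul_right,
    ← mul_assoc] at h
  by_contra h0
  have h1 := mul_right_cancel₀ h0 (h.trans (one_mul _).symm)
  apply hi
  apply zdChar_injective
  have h2 : (starRingEnd ℂ) (zdChar (a i)) * zdChar (a i) = 1 := by
    rw [mul_comm, Complex.mul_conj, Complex.normSq_eq_norm_sq, norm_zdChar]; simp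
  have h3 : (starRingEnd ℂ) (zdChar (a i)) ≠ 0 := left_ne_zero_of_mul_eq_one h2
  exact mul_left_cancel₀ h3 (h2.trans h1.symm)

/-- The conjugation action of a subgroup `G` of the normalizer of `K`. -/
def conjAction {L : Type u} [Group L] {K G : Subgroup L}
    (hG : G ≤ Subgroup.normalizer (K : Set L)) : G →* MulAut K :=
  K.normalizerMonoidHom.comp (Subgroup.inclusion hG)

lemma conjAction_eq_self {K G : Subgroup (H ≃ₗᵢ[ℂ] H)}
    (hG : G ≤ Subgroup.normalizer (K : Set (H ≃ₗᵢ[ℂ] H))) {k : K} {c : ℂ}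
    (hk : ∀ v : H, (k : H ≃ₗᵢ[ℂ] H) v = c • v) (g : G) : conjAction hG g k = k := by
  refine Subtype.ext (LinearIsometryEquiv.ext fun v => ?_)
  change (g : H ≃ₗᵢ[ℂ] H) ((k : H ≃ₗᵢ[ℂ] H) ((g : H ≃ₗᵢ[ℂ] H).symm v)) = (k : H ≃ₗᵢ[ℂ] H) v
  rw [hk, hk, map_smul, LinearIsometryEquiv.apply_symm_apply]

lemma comp_finsetSum {ι : Type*} (s : Finset ι) (B : H →ₗ[ℂ] H) (P : ι → (H →ₗ[ℂ] H)) :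
    B ∘ₗ (∑ i ∈ s, P i) = ∑ i ∈ s, B ∘ₗ P i := by
  ext v; simp [LinearMap.sum_apply]

variable [FiniteDimensional ℂ H]

/-- The projective measurement `Π_A : ℤ_d^n → Proj(H)` obtained by simultaneously diagonalizing
`(A₁, …, Aₙ)`: the orthogonal projections onto the joint eigenspaces. -/
def jointProj {n : ℕ} (A : Fin n → (H ≃ₗᵢ[ℂ] H)) (a : Fin n → Zd.{u} d) : H →ₗ[ℂ] H :=
  (jointEigenspace A a).starProjection.toLinearMap

lemma iSup_jointEigenspace {n : ℕ} {A : Fin n → (H ≃ₗᵢ[ℂ] H)} (hA : IsCommTorsion d A) :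
    ⨆ a : Fin n → Zd.{u} d, jointEigenspace A a = ⊤ := by
  set T : Fin n → Module.End ℂ H := fun i => (A i).toLinearEquiv.toLinearMap with hT
  have hpow : ∀ i, T i ^ d = 1 := fun i => by
    have h : ∀ (m : ℕ) (v : H), (T i ^ m) v = (A i ^ m) v := fun m => by
      induction m with
      | zero => intro v; simp
      | succ m ih => intro v; rw [pow_succ, pow_succ, Module.End.mul_apply, ih]; rfl
    ext v
    rw [h, hA.1 i]; rfl
  have hss : ∀ i, (T i).IsSemisimple := fun i => by
    have hs : (Polynomial.X ^ d - 1 : Polynomial ℂ).Separable :=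
      Polynomial.separable_X_pow_sub_C 1 (Nat.cast_ne_zero.2 (NeZero.ne d)) one_ne_zero
    refine Module.End.isSemisimple_of_squarefree_aeval_eq_zero hs.squarefree ?_
    simp [hpow]
  have hcomm : Pairwise fun i j => Commute (T i) (T j) := fun i j _ => by
    ext v
    exact congrArg (fun B : H ≃ₗᵢ[ℂ] H => B v) (hA.2 i j)
  have hmax : ∀ i μ, (T i).maxGenEigenspace μ = (T i).eigenspace μ := fun i μ =>
    (hss i).isFinitelySemisimple.maxGenEigenspace_eq_eigenspace μ
  have key := Module.End.iSup_iInf_maxGenEigenspace_eq_top_of_iSup_maxGenEigenspace_eq_top_of_commute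
    T hcomm (fun i => Module.End.iSup_maxGenEigenspace_eq_top _)
  rw [eq_top_iff, ← key]
  refine iSup_le fun χ => ?_
  simp only [hmax]
  by_cases hbot : ⨅ i, (T i).eigenspace (χ i) = ⊥
  · rw [hbot]; exact bot_le
  · obtain ⟨v, hv, hv0⟩ := Submodule.exists_mem_ne_zero_of_ne_bot hbot
    have hχ : ∀ i, ∃ a : Zd.{u} d, zdChar a = χ i := fun i => by
      apply exists_zdChar
      have hvi := (Submodule.mem_iInf _).1 hv i
      have hp : ∀ m : ℕ, (T i ^ m) v = χ i ^ m • v := fun m => by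
        induction m with
        | zero => simp
        | succ m ih =>
          rw [pow_succ, Module.End.mul_apply, Module.End.mem_eigenspace_iff.1 hvi, map_smul, ih,
            smul_smul, pow_succ, mul_comm]
      have := hp d
      rw [hpow] at this
      have h0 : (χ i ^ d - 1) • v = 0 := by
        rw [sub_smul, ← this]; simp
      exact sub_eq_zero.1 ((smul_eq_zero.1 h0).resolve_right hv0)
    choose a ha using hχ
    refine le_iSup_of_le a ?_
    simp only [jointEigenspace, ha]
    exact le_rfl

lemma sum_jointProj {n : ℕ} {A : Fin n → (H ≃ₗᵢ[ℂ] H)} (hA : IsCommTorsion d A) :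
    ∑ a : Fin n → Zd.{u} d, jointProj A a = LinearMap.id := by
  have hfam : OrthogonalFamily ℂ (fun a : Fin n → Zd.{u} d => jointEigenspace A a)
      (fun a => (jointEigenspace A a).subtypeₗᵢ) :=
    OrthogonalFamily.of_pairwise fun a b hab => jointEigenspace_orthogonal A hab
  ext v
  have := hfam.sum_projection_of_mem_iSup v (by rw [iSup_jointEigenspace hA]; trivial)
  simpa [jointProj, LinearMap.sum_apply] using this

/-- Coarse-graining: the measurement of a pulled back tuple is the pushforward measurement. -/
lemma jointProj_tuplePullback {m n : ℕ} {A : Fin n → (H ≃ₗᵢ[ℂ] H)} (hA : IsCommTorsion d A)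
    (f : Fin (m + 1) → Fin (n + 1)) (b : Fin m → Zd.{u} d) :
    jointProj (tuplePullback f A) b =
      ∑ a : Fin n → Zd.{u} d, if tuplePullback f a = b then jointProj A a else 0 := by
  classical
  rw [← LinearMap.comp_id (jointProj (tuplePullback f A) b), ← sum_jointProj hA]
  ext v
  simp only [LinearMap.comp_apply, LinearMap.sum_apply, map_sum]
  refine Finset.sum_congr rfl fun a _ => ?_
  have hmem : jointProj A a v ∈ jointEigenspace (tuplePullback f A) (tuplePullback f a) :=
    jointEigenspace_le A a f (Submodule.starProjection_apply_mem _ v)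
  split_ifs with h
  · subst h
    exact Submodule.starProjection_eq_self_iff.2 hmem
  · refine (Submodule.starProjection_apply_eq_zero_iff _).2 ?_
    exact (jointEigenspace_orthogonal (tuplePullback f A) h) hmem

variable (H) in
/-- Density operators on `H`. -/
structure DensityOperator where
  /-- the operator -/
  toLin : H →ₗ[ℂ] H
  isPositive : toLin.IsPositive
  trace_eq_one : LinearMap.trace ℂ H toLin = 1

/-- The Born rule probability `Tr(ρ Π_A(a))`. -/
def bornWeight (ρ : DensityOperator H) {n : ℕ} (A : Fin n → (H ≃ₗᵢ[ℂ] H))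
    (a : Fin n → Zd.{u} d) : ℝ :=
  (LinearMap.trace ℂ H (ρ.toLin ∘ₗ jointProj A a)).re

lemma bornWeight_nonneg (ρ : DensityOperator H) {n : ℕ} (A : Fin n → (H ≃ₗᵢ[ℂ] H))
    (a : Fin n → Zd.{u} d) : 0 ≤ bornWeight ρ A a := by
  have hid : jointProj A a = jointProj A a ∘ₗ jointProj A a := by
    ext v
    exact (Submodule.starProjection_eq_self_iff.2 (Submodule.starProjection_apply_mem _ v)).symm
  have h : LinearMap.trace ℂ H (ρ.toLin ∘ₗ jointProj A a) =
      LinearMap.trace ℂ H (jointProj A a ∘ₗ ρ.toLin ∘ₗ jointProj A a) := by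
    conv_lhs => rw [hid, ← LinearMap.comp_assoc, LinearMap.trace_comp_comm']
  rw [bornWeight, h, LinearMap.trace_eq_sum_inner _ (stdOrthonormalBasis ℂ H), Complex.re_sum]
  refine Finset.sum_nonneg fun i _ => ?_
  have := ρ.isPositive.re_inner_nonneg_right (jointProj A a (stdOrthonormalBasis ℂ H i))
  have h2 := Submodule.inner_starProjection_left_eq_right (jointEigenspace A a)
    (stdOrthonormalBasis ℂ H i) (ρ.toLin (jointProj A a (stdOrthonormalBasis ℂ H i)))
  rw [LinearMap.comp_apply, LinearMap.comp_apply]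
  change 0 ≤ (inner ℂ _ ((jointEigenspace A a).starProjection _)).re
  rw [← h2]
  exact this

/-- The Born rule distribution on `ℤ_d^n` of a commuting `d`-torsion tuple. -/
def bornDist (ρ : DensityOperator H) {n : ℕ} (A : Fin n → (H ≃ₗᵢ[ℂ] H))
    (hA : IsCommTorsion d A) : Convexity.StdSimplex ℝ (Fin n → Zd.{u} d) where
  weights := Finsupp.equivFunOnFinite.symm (bornWeight ρ A)
  nonneg := fun a => bornWeight_nonneg ρ A a
  total := by
    rw [Finsupp.sum_fintype _ _ (fun _ => rfl)]
    simp only [Finsupp.equivFunOnFinite_symm_apply_apply, bornWeight]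
    rw [← Complex.re_sum, ← map_sum, ← comp_finsetSum, sum_jointProj hA, LinearMap.comp_id,
      ρ.trace_eq_one, Complex.one_re]

lemma bornDist_tuplePullback (ρ : DensityOperator H) {m n : ℕ} (A : Fin n → (H ≃ₗᵢ[ℂ] H))
    (hA : IsCommTorsion d A) (f : Fin (m + 1) → Fin (n + 1)) :
    bornDist ρ (tuplePullback f A) (hA.face f) =
      (bornDist ρ A hA).map (tuplePullback f : (Fin n → Zd.{u} d) → Fin m → Zd.{u} d) := by
  classical
  refine Convexity.StdSimplex.ext (Finsupp.ext fun b => ?_)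
  change bornWeight ρ (tuplePullback f A) b = _
  rw [Convexity.StdSimplex.weights_map, Finsupp.mapDomain,
    Finsupp.sum_fintype _ _ (fun _ => Finsupp.single_zero _),
    Finsupp.finsetSum_apply, bornWeight, jointProj_tuplePullback hA, comp_finsetSum,
    map_sum, Complex.re_sum]
  refine Finset.sum_congr rfl fun a _ => ?_
  rw [Finsupp.single_apply]
  split_ifs
  · rfl
  · simp

/-- The simplicial Born rule `ρ_* : N(ℤ_d, U(H)) → D(N ℤ_d)`. -/
def born (d : ℕ) [NeZero d] (ρ : DensityOperator H) :
    (torsionNerve d (H ≃ₗᵢ[ℂ] H) : SSet.{u}) ⟶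
      ((SimplicialObject.whiskering (Type u) (Type u)).obj distFunctor).obj
        (groupNerve (Zd.{u} d)) where
  app _ := TypeCat.ofHom fun A => bornDist ρ A.1 A.2
  naturality _ _ θ := typeHomExt fun A =>
    bornDist_tuplePullback ρ A.1 A.2 θ.unop.toOrderHom

/-- A quantum state is `G`-equivariant if `U ρ U† = ρ` for all `U ∈ G`
(for a unitary operator `U† = U⁻¹`). -/
def DensityOperator.IsEquivariant (ρ : DensityOperator H) (G : Subgroup (H ≃ₗᵢ[ℂ] H)) : Prop :=
  ∀ U ∈ G, U.toLinearEquiv.toLinearMap ∘ₗ ρ.toLin ∘ₗ U⁻¹.toLinearEquiv.toLinearMap = ρ.toLin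

lemma jointProj_conj {n : ℕ} (A : Fin n → (H ≃ₗᵢ[ℂ] H)) (a : Fin n → Zd.{u} d)
    (U : H ≃ₗᵢ[ℂ] H) :
    jointProj (fun i => U * A i * U⁻¹) a =
      U.toLinearEquiv.toLinearMap ∘ₗ jointProj A a ∘ₗ U⁻¹.toLinearEquiv.toLinearMap := by
  have hsp : jointEigenspace (fun i => U * A i * U⁻¹) a =
      (jointEigenspace A a).map U.toLinearEquiv.toLinearMap := by
    ext v
    rw [Submodule.mem_map_equiv, mem_jointEigenspace, mem_jointEigenspace]
    refine forall_congr' fun i => ?_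
    change U (A i (U.symm v)) = _ ↔ A i (U.symm v) = zdChar (a i) • U.symm v
    rw [← map_smul U.symm, LinearIsometryEquiv.eq_symm_apply]
  ext v
  rw [jointProj]
  simp only [hsp]
  exact Submodule.starProjection_map_apply U (jointEigenspace A a) v

lemma bornWeight_conj (ρ : DensityOperator H) {G : Subgroup (H ≃ₗᵢ[ℂ] H)}
    (hρ : ρ.IsEquivariant G) {U : H ≃ₗᵢ[ℂ] H} (hU : U ∈ G) {n : ℕ}
    (A : Fin n → (H ≃ₗᵢ[ℂ] H)) (a : Fin n → Zd.{u} d) :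
    bornWeight ρ (fun i => U * A i * U⁻¹) a = bornWeight ρ A a := by
  have h1 := hρ _ (inv_mem hU)
  rw [inv_inv] at h1
  rw [bornWeight, bornWeight, jointProj_conj]
  conv_rhs => rw [← h1]
  rw [← LinearMap.comp_assoc, ← LinearMap.comp_assoc, LinearMap.trace_comp_comm']
  simp only [LinearMap.comp_assoc]

/-- The Born rule distribution `ρ_* : N(ℤ_d, K) → D(N ℤ_d)` of a `G`-equivariant quantum state,
as a `G`-equivariant simplicial distribution. The group `G` acts on `N(ℤ_d, K)` by conjugation
and trivially on `N ℤ_d`. -/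
def bornEquivariant (d : ℕ) [NeZero d] {K G : Subgroup (H ≃ₗᵢ[ℂ] H)}
    (hG : G ≤ Subgroup.normalizer (K : Set (H ≃ₗᵢ[ℂ] H)))
    (ρ : DensityOperator H) (hρ : ρ.IsEquivariant G) :
    torsionNerveAction d (conjAction hG) ⟶
      distAction (Action.trivial G (groupNerve (Zd.{u} d))) where
  hom := torsionNerveMap d K.subtype ≫ born d ρ
  comm g := ssetHomExt fun n k => by
    have hmap : ∀ p : Convexity.StdSimplex ℝ (Fin n.unop.len → Zd.{u} d), p.map (fun x => x) = p :=
      fun p => Convexity.StdSimplex.map_id p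
    refine Eq.trans ?_ (hmap _).symm
    exact Convexity.StdSimplex.ext (Finsupp.ext fun a =>
      bornWeight_conj ρ hρ g.2 (fun i => (k.1 i : H ≃ₗᵢ[ℂ] H)) a)

end Quantum

end
end EquivContext

namespace EquivContext

universe u

open CategoryTheory Simplicial Opposite

/-! Suppose `ρ_*` is a mixture of simplicial `G`-maps `r : N(ℤ_d, K) → N ℤ_d`. A single `r` of
positive weight already forces `[β_G] = 0`.

In degree one, `r` is a function `f` from the `d`-torsion elements of `K` to `ℤ_d`. A commuting pair
`(k, l)` of such elements is a 2-simplex with faces `l`, `kl`, `k`, so compatibility with faces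
gives `f (kl) = f k + f l` (`edgeValue_mul`). Since `G` acts trivially on `N ℤ_d`, equivariance says
that `f` is `G`-invariant. Finally `J` is the scalar `e^{2πi/d}`, so the Born rule gives its outcome
`1` with certainty, and any `r` in the support must satisfy `f J = 1`
(`zdChar_eq_of_bornWeight_ne_zero`, `weights_map_ne_zero`). Hence `f` inverts `a ↦ J ^ a` on `⟨J⟩`.

Now apply `f` to `J ^ β · η(x₁x₂) = η(x₁) · (g₁ · η(g₁⁻¹ x₂))`. All factors are `d`-torsion, and the
factors on each side commute, so `β = f(η(g₁⁻¹ x₂)) - f(η(x₁x₂)) + f(η(x₁))`. This is the coboundary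
of the 1-cochain `[(1, g₁), x] ↦ f(η(x))` (`log_sectionDefect_eq`, `betaGClass_eq_zero`). -/

lemma tuplePullback_succAbove {L : Type u} [Group L] (k : Fin 2 → L) :
    tuplePullback (m := 1) (Fin.succAbove 0) k = (fun _ => k 1) ∧
      tuplePullback (m := 1) (Fin.succAbove 1) k = (fun _ => k 0 * k 1) ∧
      tuplePullback (m := 1) (Fin.succAbove 2) k = (fun _ => k 0) := by
  have h1 : Fin.partialProd k 1 = k 0 := by simp [Fin.partialProd, List.ofFn_succ]
  have h2 : Fin.partialProd k 2 = k 0 * k 1 := by simp [Fin.partialProd, List.ofFn_succ]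
  refine ⟨funext fun i => ?_, funext fun i => ?_, funext fun i => ?_⟩ <;>
    obtain rfl : i = 0 := Subsingleton.elim _ _
  · change (Fin.partialProd k 1)⁻¹ * Fin.partialProd k 2 = k 1
    rw [h1, h2, inv_mul_cancel_left]
  · change (Fin.partialProd k 0)⁻¹ * Fin.partialProd k 2 = k 0 * k 1
    rw [h2, Fin.partialProd_zero, inv_one, one_mul]
  · change (Fin.partialProd k 0)⁻¹ * Fin.partialProd k 1 = k 0
    rw [h1, Fin.partialProd_zero, inv_one, one_mul]

/-! ### Trivializing `β_G` by an invariant, partially additive function -/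

section Trivialization

variable {K G : Type u} [Group K] [Group G] {d : ℕ} {J : CentralElement K d}
  (φ : G →* MulAut K) (hφ : ∀ g, φ g J.val = J.val) (η : NormalizedSection J)

lemma CentralElement.pow_eq_one_of_mem {j : K} (hj : j ∈ Subgroup.zpowers J.val) : j ^ d = 1 := by
  obtain ⟨z, rfl⟩ := hj
  change (J.val ^ z) ^ d = 1
  have h : J.val ^ d = 1 := orderOf_dvd_iff_pow_eq_one.1 J.orderOf_eq.dvd
  rw [← zpow_natCast, zpow_comm, zpow_natCast, h, one_zpow]

lemma CentralElement.commute_of_mem {j : K} (hj : j ∈ Subgroup.zpowers J.val) (k : K) :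
    Commute j k :=
  (Subgroup.mem_center_iff.1 (Subgroup.zpowers_le.2 J.mem_center hj) k).symm

lemma CentralElement.exists_mul_of_mk_eq {k l : K} (h : (k : J.Quot) = (l : J.Quot)) :
    ∃ j ∈ Subgroup.zpowers J.val, l = k * j :=
  ⟨k⁻¹ * l, QuotientGroup.eq.1 h, by group⟩

/-- Being `d`-torsion depends only on the class modulo `⟨J⟩`. -/
lemma CentralElement.pow_eq_one_of_mk_eq {k l : K} (h : (k : J.Quot) = (l : J.Quot))
    (hk : k ^ d = 1) : l ^ d = 1 := by
  -- Two lifts of one class differ by a factor `j ∈ ⟨J⟩`, which is central and satisfies `j ^ d =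
  -- 1`.
  obtain ⟨j, hj, rfl⟩ := J.exists_mul_of_mk_eq h
  rw [(J.commute_of_mem hj k).symm.mul_pow, hk, J.pow_eq_one_of_mem hj, one_mul]

/-- Commutation depends only on the classes modulo `⟨J⟩`. -/
lemma CentralElement.commute_of_mk_eq {k l k' l' : K} (hk : (k : J.Quot) = (k' : J.Quot))
    (hl : (l : J.Quot) = (l' : J.Quot)) (h : Commute k l) : Commute k' l' := by
  obtain ⟨i, hi, rfl⟩ := J.exists_mul_of_mk_eq hk
  obtain ⟨j, hj, rfl⟩ := J.exists_mul_of_mk_eq hl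
  exact (h.mul_right (J.commute_of_mem hj k).symm).mul_left (J.commute_of_mem hi _)

variable [NeZero d]

/-- A function that is additive on commuting pairs of `d`-torsion elements and takes the value
`1` at `J` restricts to the inverse of `a ↦ J ^ a`. -/
lemma CentralElement.eq_log (f : K → ZMod d)
    (hmul : ∀ k l, k ^ d = 1 → l ^ d = 1 → Commute k l → f (k * l) = f k + f l)
    (hJ : f J.val = 1) {j : K} (hj : j ∈ Subgroup.zpowers J.val) : f j = J.log j := by
  have h1 : f 1 = 0 := by simpa using hmul 1 1 (one_pow d) (one_pow d) rfl
  -- Additivity is available along the whole induction because the powers of `J` are `d`-torsion and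
  -- commute with one another.
  have hpow : ∀ n : ℕ, f (J.val ^ n) = n := fun n => by
    induction n with
    | zero => simpa using h1
    | succ n ih =>
      rw [pow_succ, hmul _ _ (J.pow_eq_one_of_mem (Subgroup.npow_mem_zpowers _ n))
        (J.pow_eq_one_of_mem (Subgroup.mem_zpowers _)) (Commute.pow_self _ _), ih, hJ]
      push_cast; rfl
  conv_lhs => rw [← J.pow_log hj, hpow]
  exact ZMod.natCast_zmod_val _

/-- The `1`-cochain `[(g₀, g₁), x] ↦ f(η(g₀⁻¹ x))`. -/
def sectionCochain (f : K → ZMod d) : (borel (barTorsionNerveAction J φ hφ)) _⦋1⦌ → ZMod d :=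
  Quotient.lift
    (fun p => f (η.toFun (quotMap J φ hφ p.1.1⁻¹
      ((barTorsionNerve J).ι.app (op ⦋1⦌) p.2 (0 : Fin 1))))) (by
      rintro ⟨⟨g₀, g⟩, x⟩ q ⟨h, rfl⟩
      change f (η.toFun (quotMap J φ hφ g₀⁻¹ (x.1 (0 : Fin 1)))) =
        f (η.toFun (quotMap J φ hφ (h * g₀)⁻¹ (quotMap J φ hφ h (x.1 (0 : Fin 1)))))
      -- Independence of the orbit representative comes from `(h g₀)⁻¹ h = g₀⁻¹`.
      rw [← quotMap_mul]
      congr 4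
      group)

variable {φ η} in
-- The coboundary formula at a representative with `g₀ = 1`. The arbitrary section `η` need not
-- respect products, but its values inherit torsion and commutation from the lifts `k`, `l`, since
-- both properties depend only on classes modulo `⟨J⟩`. This makes `f` additive on each side of
-- `defect · c = a · b`.
lemma log_sectionDefect_eq (f : K → ZMod d)
    (hmul : ∀ k l, k ^ d = 1 → l ^ d = 1 → Commute k l → f (k * l) = f k + f l)
    (hinv : ∀ g k, k ^ d = 1 → f (φ g k) = f k) (hJ : f J.val = 1) (g : G) {k l : K}
    (hk : k ^ d = 1) (hl : l ^ d = 1) (hkl : Commute k l) :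
    J.log (sectionDefect φ hφ η g k l) =
      f (η.toFun (quotMap J φ hφ g⁻¹ l)) - f (η.toFun ((k : J.Quot) * l)) + f (η.toFun k) := by
  set a := η.toFun (k : J.Quot) with ha
  set b := φ g (η.toFun (quotMap J φ hφ g⁻¹ l)) with hb
  set c := η.toFun ((k : J.Quot) * l) with hc
  have mka : (k : J.Quot) = (a : J.Quot) := (η.mk_toFun _).symm
  have mkb : (l : J.Quot) = (b : J.Quot) := (mk_conjSection φ hφ η g _).symm
  have mkc : ((k * l : K) : J.Quot) = (c : J.Quot) := (η.mk_toFun _).symm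
  have ta := J.pow_eq_one_of_mk_eq mka hk
  have tb := J.pow_eq_one_of_mk_eq mkb hl
  have tc : c ^ d = 1 := J.pow_eq_one_of_mk_eq mkc (by rw [hkl.mul_pow, hk, hl, one_mul])
  have hab : Commute a b := J.commute_of_mk_eq mka mkb hkl
  have hmem := sectionDefect_mem φ hφ η g (k : J.Quot) l
  have hprod : sectionDefect φ hφ η g k l * c = a * b := by
    rw [sectionDefect, inv_mul_cancel_right]
  -- The defect lies in `⟨J⟩`, so it is `d`-torsion and commutes with `c`; on it `f` agrees with
  -- `J.log`.
  have hsum := hmul _ c (J.pow_eq_one_of_mem hmem) tc (J.commute_of_mem hmem c)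
  -- Invariance of `f` is assumed only on torsion elements; torsion is pulled back from `b` along
  -- the automorphism `φ g`.
  have htor : (η.toFun (quotMap J φ hφ g⁻¹ l)) ^ d = 1 := by
    apply (φ g).injective
    rw [map_pow, map_one]
    exact tb
  rw [hprod, hmul a b ta tb hab, J.eq_log f hmul hJ hmem, hb, hinv g _ htor] at hsum
  linear_combination -hsum

/-- A `G`-invariant function on the `d`-torsion elements that is additive on commuting pairs and
takes the value `1` at `J` trivializes `β_G`. -/
lemma betaGClass_eq_zero (f : K → ZMod d)
    (hmul : ∀ k l, k ^ d = 1 → l ^ d = 1 → Commute k l → f (k * l) = f k + f l)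
    (hinv : ∀ g k, k ^ d = 1 → f (φ g k) = f k) (hJ : f J.val = 1) :
    betaGClass φ hφ η = 0 := by
  rw [betaGClass, QuotientAddGroup.eq_zero_iff, AddSubgroup.mem_addSubgroupOf]
  refine ⟨sectionCochain φ hφ η f, ?_⟩
  funext σ
  induction σ using Quotient.inductionOn with
  | h p =>
    -- Membership in `N̄(ℤ_d, K)` supplies a simultaneous lift `k` of `x` that is commuting and
    -- `d`-torsion.
    obtain ⟨⟨g₀, g⟩, x, k, ⟨htor, hcomm⟩, hx⟩ := p
    obtain rfl : (fun i => (k i : J.Quot)) = x := funext hx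
    change Fin 2 → G at g
    change Fin 2 → K at k
    -- Translating by `g₀⁻¹` moves the simplex to the representative with first coordinate `1`.
    have key := log_sectionDefect_eq (η := η) hφ f hmul hinv hJ (g 0)
      (k := φ g₀⁻¹ (k 0)) (l := φ g₀⁻¹ (k 1))
      (by rw [← map_pow, htor, map_one]) (by rw [← map_pow, htor, map_one])
      (by rw [Commute, SemiconjBy, ← map_mul, hcomm, map_mul])
    change ∑ i : Fin 3, (-1 : ℤ) ^ (i : ℕ) • f (η.toFun (quotMap J φ hφ
      (g₀ * Fin.partialProd g (i.succAbove 0))⁻¹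
      (tuplePullback i.succAbove (fun i => (k i : J.Quot)) (0 : Fin 1)))) =
      J.log (sectionDefect φ hφ η (g 0) (φ g₀⁻¹ (k 0) : K) (φ g₀⁻¹ (k 1) : K))
    rw [key, Fin.sum_univ_three]
    obtain ⟨b0, b1, b2⟩ := tuplePullback_succAbove (fun i => (k i : J.Quot))
    have hg : Fin.partialProd g 1 = g 0 := by simp [Fin.partialProd, List.ofFn_succ]
    rw [b0, b1, b2]
    -- Only the face `d₀` changes the base point, from `g₀` to `g₀g₁`; this produces the `g₁⁻¹` in
    -- the term of `x₂`.
    change (-1 : ℤ) ^ 0 • f (η.toFun (quotMap J φ hφ (g₀ * Fin.partialProd g 1)⁻¹ (k 1))) +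
      (-1 : ℤ) ^ 1 • f (η.toFun (quotMap J φ hφ (g₀ * Fin.partialProd g 0)⁻¹ (k 0 * k 1))) +
      (-1 : ℤ) ^ 2 • f (η.toFun (quotMap J φ hφ (g₀ * Fin.partialProd g 0)⁻¹ (k 0))) = _
    rw [hg, Fin.partialProd_zero, mul_one, mul_inv_rev, quotMap_mul, map_mul]
    simp [sub_eq_add_neg]

end Trivialization

/-! ### Certain outcomes and supports of distributions -/

section Quantum

variable {H : Type u} [NormedAddCommGroup H] [InnerProductSpace ℂ H] {d : ℕ} [NeZero d]

/-- If `A` is a scalar, the only outcome of positive probability is its eigenvalue. -/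
lemma zdChar_eq_of_bornWeight_ne_zero [FiniteDimensional ℂ H] (ρ : DensityOperator H) {n : ℕ}
    {A : Fin n → (H ≃ₗᵢ[ℂ] H)} {a : Fin n → Zd.{u} d} (h : bornWeight ρ A a ≠ 0) {i : Fin n}
    {c : ℂ} (hA : ∀ v, A i v = c • v) : zdChar (a i) = c := by
  -- A zero eigenspace would give the zero projection, hence weight zero. A nonzero joint
  -- eigenvector can then be used to compare the two eigenvalues of `A i`.
  have hne : jointEigenspace A a ≠ ⊥ := fun hbot => h (by
    simp [bornWeight, jointProj, hbot])
  obtain ⟨v, hv, hv0⟩ := Submodule.exists_mem_ne_zero_of_ne_bot hne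
  have := mem_jointEigenspace.1 hv i
  rw [hA] at this
  exact (smul_left_injective ℂ hv0 this).symm

lemma zdChar_ofAdd_one : zdChar (⟨Multiplicative.ofAdd 1⟩ : Zd.{u} d) =
    Complex.exp (2 * Real.pi * Complex.I / d) := by
  have := ZMod.stdAddChar_coe (N := d) 1
  simpa [zdChar] using this

end Quantum

/-- Outcomes attained by a deterministic map of positive weight have positive probability. -/
lemma weights_map_ne_zero {α β : Type*} (w : Convexity.StdSimplex ℝ α) (f : α → β) {r : α}
    (hr : w.weights r ≠ 0) : (w.map f).weights (f r) ≠ 0 := by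
  classical
  rw [Convexity.StdSimplex.weights_map, Finsupp.mapDomain, Finsupp.sum, Finsupp.finsetSum_apply]
  -- The mass at `f r` is a sum of nonnegative terms, one of which is the weight of `r`; nothing
  -- cancels.
  refine (lt_of_lt_of_le ((w.nonneg r).lt_of_ne' hr) ?_).ne'
  have := Finset.single_le_sum (f := fun a => (Finsupp.single (f a) (w.weights a)) (f r))
    (s := w.weights.support)
    (fun a _ => by rw [Finsupp.single_apply]; split_ifs; exacts [w.nonneg a, le_rfl])
    (Finsupp.mem_support_iff.2 hr)
  simpa using this

lemma exists_weights_ne_zero {α : Type*} (w : Convexity.StdSimplex ℝ α) :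
    ∃ r, w.weights r ≠ 0 := by
  by_contra! h
  have h0 : w.weights = 0 := Finsupp.ext h
  have := w.total
  simp [h0] at this

/-! ### Degree-one data of a simplicial map to `N ℤ_d` -/

section Deterministic

variable {K : Type u} [Group K] {d : ℕ}

lemma isCommTorsion_const {k : K} (hk : k ^ d = 1) : IsCommTorsion d (fun _ : Fin 1 => k) :=
  ⟨fun _ => hk, fun _ _ => rfl⟩

open Classical in
/-- The function on `K` given on `d`-torsion elements by a simplicial map `N(ℤ_d, K) → N ℤ_d` in
degree one, and by `0` elsewhere. -/
noncomputable def edgeValue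
    (r : (torsionNerve d K : SSet.{u}) ⟶ groupNerve (Zd.{u} d)) (k : K) : ZMod d :=
  if hk : k ^ d = 1 then
    (r.app (op ⦋1⦌) ⟨fun _ => k, isCommTorsion_const hk⟩ (0 : Fin 1)).down.toAdd
  else 0

lemma edgeValue_of_pow_eq_one (r : (torsionNerve d K : SSet.{u}) ⟶ groupNerve (Zd.{u} d)) {k : K}
    (hk : k ^ d = 1) : edgeValue r k =
      (r.app (op ⦋1⦌) ⟨fun _ => k, isCommTorsion_const hk⟩ (0 : Fin 1)).down.toAdd :=
  dif_pos hk

/-- The pair `(k, l)` is a 2-simplex, and its image `y` has faces `y 1`, `y 0 * y 1`, `y 0`, which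
must be the images of `l`, `k * l`, `k`. -/
lemma edgeValue_mul (r : (torsionNerve d K : SSet.{u}) ⟶ groupNerve (Zd.{u} d)) (k l : K)
    (hk : k ^ d = 1) (hl : l ^ d = 1) (hkl : Commute k l) :
    edgeValue r (k * l) = edgeValue r k + edgeValue r l := by
  have hσ : IsCommTorsion d ![k, l] := by
    refine ⟨fun i => ?_, fun i j => ?_⟩
    · fin_cases i <;> simp [hk, hl]
    · fin_cases i <;> fin_cases j <;> simp [hkl.eq]
  let σ : (torsionNerve d K : SSet.{u}) _⦋2⦌ := ⟨![k, l], hσ⟩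
  set y : Fin 2 → Zd.{u} d := r.app (op ⦋2⦌) σ with hy
  -- Naturality of `r` at the coface map `δ i`, read off on the single coordinate of an edge.
  have hface : ∀ i : Fin 3, ∀ m : K, ∀ hm : m ^ d = 1,
      tuplePullback (m := 1) i.succAbove ![k, l] = (fun _ => m) →
      edgeValue r m = (tuplePullback (m := 1) i.succAbove y 0).down.toAdd := fun i m hm h => by
    rw [edgeValue_of_pow_eq_one r hm]
    have h1 := ConcreteCategory.congr_hom (r.naturality (SimplexCategory.δ i).op) σ
    have h2 : (torsionNerve d K : SSet.{u}).map (SimplexCategory.δ i).op σ =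
        ⟨fun _ => m, isCommTorsion_const hm⟩ := Subtype.ext h
    have h3 : r.app (op ⦋1⦌) ⟨fun _ => m, isCommTorsion_const hm⟩ =
        tuplePullback (m := 1) i.succAbove y := by
      rw [← h2]; exact h1
    rw [h3]
  obtain ⟨a0, a1, a2⟩ := tuplePullback_succAbove ![k, l]
  obtain ⟨b0, b1, b2⟩ := tuplePullback_succAbove y
  rw [hface 1 (k * l) (by rw [hkl.mul_pow, hk, hl, one_mul]) a1, hface 2 k hk a2, hface 0 l hl a0,
    b0, b1, b2]
  rfl

end Deterministic

end EquivContext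

theorem mainTheorem9 {H : Type*} [NormedAddCommGroup H] [InnerProductSpace ℂ H]
    [FiniteDimensional ℂ H] (d : ℕ) [NeZero d] (hd : 2 ≤ d)
    (K G : Subgroup (H ≃ₗᵢ[ℂ] H))
    (hG : G ≤ Subgroup.normalizer (K : Set (H ≃ₗᵢ[ℂ] H)))
    (J : EquivContext.CentralElement K d)
    (hJ : ∀ v : H, (J.val : H ≃ₗᵢ[ℂ] H) v =
      Complex.exp (2 * Real.pi * Complex.I / d) • v)
    (η : EquivContext.NormalizedSection J)
    (hβ : EquivContext.betaGClass (EquivContext.conjAction hG)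
      (EquivContext.conjAction_eq_self hG hJ) η ≠ 0)
    (ρ : EquivContext.DensityOperator H) (hρ : ρ.IsEquivariant G) :
    EquivContext.IsEquivariantlyContextual (EquivContext.bornEquivariant d hG ρ hρ) := by
  open EquivContext CategoryTheory Opposite Simplicial in
  rintro ⟨w, hw⟩
  -- One deterministic map in the support suffices; the rest of the mixture plays no role.
  obtain ⟨r, hr⟩ := exists_weights_ne_zero w
  refine hβ (betaGClass_eq_zero _ _ η (edgeValue r.hom) (edgeValue_mul r.hom) ?_ ?_)
  · intro g k hk
    have hgk : (conjAction hG g k) ^ d = 1 := by rw [← map_pow, hk, map_one]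
    refine (edgeValue_of_pow_eq_one r.hom hgk).trans
      (Eq.trans ?_ (edgeValue_of_pow_eq_one r.hom hk).symm)
    -- The action on `N ℤ_d` is trivial, so equivariance of `r` on the edge `k` is invariance of its
    -- value.
    have h := ConcreteCategory.congr_hom (NatTrans.congr_app (r.comm g) (op ⦋1⦌))
      ⟨fun _ => k, isCommTorsion_const hk⟩
    exact congrArg (fun y : Fin 1 → Zd d => (y 0).down.toAdd) h
  · have hJd : J.val ^ d = 1 := J.pow_eq_one_of_mem (Subgroup.mem_zpowers _)
    refine (edgeValue_of_pow_eq_one r.hom hJd).trans ?_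
    set σ : (torsionNerve d K : SSet) _⦋1⦌ := ⟨fun _ => J.val, isCommTorsion_const hJd⟩ with hσ
    -- The value of `r` on the edge `J` has positive mass in the mixture, hence positive Born
    -- probability by `hw`. Since `J` is the scalar `e^{2πi/d}`, injectivity of the character leaves
    -- only the outcome `1`.
    have h1 := weights_map_ne_zero w (fun r => r.hom.app (op ⦋1⦌) σ) hr
    have h2 : (w.map fun r => r.hom.app (op ⦋1⦌) σ) =
        (bornEquivariant d hG ρ hρ).hom.app (op ⦋1⦌) σ := by
      rw [← hw]; rfl
    rw [h2] at h1
    change bornWeight ρ (fun _ : Fin 1 => (J.val : H ≃ₗᵢ[ℂ] H)) (r.hom.app (op ⦋1⦌) σ) ≠ 0 at h1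
    have h3 := zdChar_eq_of_bornWeight_ne_zero ρ h1 (i := (0 : Fin 1)) hJ
    rw [← zdChar_ofAdd_one] at h3
    exact congrArg (fun a : Zd d => a.down.toAdd) (zdChar_injective h3)
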